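/- Let $\mathbb{F}_q$ be the finite field with $q$ elements and characteristic $p$. For $e\ge 0$ let $$h_e(x_1,\dots,x_k)=\sum_{1\le i_1\le\cdots\le i_e\le k}x_{i_1}\cdots x_{i_e}$$ be the homogeneous complete symmetric polynomial of degree $e$ in $k$ variables (with $h_0=1$). Let $3\le k\le q-2$ if $q$ is odd, and $4\le k\le q-3$ if $q$ is even. Let $m\ge 1$, let $a_0,\dots,a_m\in\mathbb{F}_q$ with $a_m\ne 0$, and put $$h(x_1,\dots,x_k)=\sum_{e=0}^m a_e h_e(x_1,\dots,x_k)\in\mathbb{F}_q[x_1,\dots,x_k].$$ Assume that $k\le p$ or $k\ge\lfloor (q+1)/2\rfloor$. Then there is a point $(x_1,\dots,x_k)\in\mathbb{F}_q^k$ with $h(x_1,\dots,x_k)=0$ and $x_i\ne x_j$ for all $i\ne j$ if and only if the remainder of $x^{k-1}\sum_{e=0}^m a_e x^e$ on division by $x^q-x$ is not a polynomial of degree equal to $k-1$. -/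

import Mathlib

open MvPolynomial in
/-- The polynomial `∑_{e ≤ m} a_e h_e` in `k` variables over `F`, where `h_e` is the homogeneous
complete symmetric polynomial of degree `e` (Mathlib's `MvPolynomial.hsymm`). It is a complete
symmetric polynomial of degree `m` when `a m ≠ 0`. -/
noncomputable def completeSymmetric (F : Type*) [Field F] (k m : ℕ) (a : ℕ → F) :
    MvPolynomial (Fin k) F :=
  ∑ e ∈ Finset.range (m + 1), C (a e) * hsymm (Fin k) F e

/-- The number of zeros of `h` in `F^k` with pairwise distinct coordinates. -/
noncomputable def numDistinctZeros {F : Type*} [Field F] {k : ℕ}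
    (h : MvPolynomial (Fin k) F) : ℕ :=
  Set.ncard {x : Fin k → F | MvPolynomial.eval x h = 0 ∧ ∀ i j, i ≠ j → x i ≠ x j}

open Polynomial in
/-- The reduction of `x^(k-1) * ∑_{e ≤ m} a_e x^e` modulo `x^q - x`, with `q = #F`: the remainder
on division by this monic polynomial. -/
noncomputable def associatedReduction (F : Type*) [Field F] [Fintype F] (k m : ℕ) (a : ℕ → F) :
    Polynomial F :=
  (X ^ (k - 1) * ∑ e ∈ Finset.range (m + 1), C (a e) * X ^ e) %ₘ (X ^ Fintype.card F - X)

/-! At distinct points `h_e` is the divided difference of `x^(k-1+e)`, so `h` is the divided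
difference of the reduction `G` of `x^(k-1) ∑ a_e x^e` (`eval_completeSymmetric`). If `deg G = k-1`,
every such difference is the leading coefficient, hence nonzero. Conversely, suppose that no
difference at `k` points vanishes. The crux is that all differences at `k+1` points then vanish: `G`
has degree below `k`, and its coefficient at `k-1` is a nonzero difference.

For `k ≥ (q+1)/2` (`divDiff_eq_zero_of_large`), take the differences `(α, β, γ)` of `f`, `x f`, `x²
f` at `k+2` points. This vector lies on no secant of a large part of a conic, so it is zero, on the
conic, or at the nucleus in characteristic 2. Excluding the nucleus and the conic points with `α ≠
0` leaves `α = β = 0`.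

For smaller `k ≤ p` (`divDiff_eq_zero_of_small`), an analogue of Segre's lemma of tangents and the
injectivity of an inclusion matrix fix certain products of differences at sets `C ∪ {z}`. Exchanging
one `z` shows that these differences do not depend on `z`, so the next difference is zero. -/

/-! ### Divided differences over finite sets of nodes. -/

section DividedDifference

variable {F : Type*} [Field F] [DecidableEq F]

/-- The divided difference of `f` at the elements of `Z`. -/
def divDiff (f : F → F) (Z : Finset F) : F :=
  ∑ x ∈ Z, f x * ∏ y ∈ Z.erase x, (x - y)⁻¹

theorem divDiff_add (f g : F → F) (Z : Finset F) :
    divDiff (fun x => f x + g x) Z = divDiff f Z + divDiff g Z := by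
  simp only [divDiff, add_mul, Finset.sum_add_distrib]

theorem divDiff_sub (f g : F → F) (Z : Finset F) :
    divDiff (fun x => f x - g x) Z = divDiff f Z - divDiff g Z := by
  simp only [divDiff, sub_mul, Finset.sum_sub_distrib]

theorem divDiff_const_mul (c : F) (f : F → F) (Z : Finset F) :
    divDiff (fun x => c * f x) Z = c * divDiff f Z := by
  simp only [divDiff, mul_assoc, Finset.mul_sum]

/-- The factor `x - a` kills the term at `a` and cancels `(x - a)⁻¹` in the others. The recurrences
below all come from this. -/
theorem divDiff_sub_mul_insert (f : F → F) {a : F} {Z : Finset F} (ha : a ∉ Z) :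
    divDiff (fun x => (x - a) * f x) (insert a Z) = divDiff f Z := by
  unfold divDiff
  rw [Finset.sum_insert ha]
  simp only [sub_self, zero_mul, zero_add]
  refine Finset.sum_congr rfl fun x hx => ?_
  have hxa : x ≠ a := fun h => ha (h ▸ hx)
  rw [Finset.erase_insert_of_ne hxa.symm,
    Finset.prod_insert (fun h => ha (Finset.mem_of_mem_erase h))]
  have := sub_ne_zero.mpr hxa
  field_simp

theorem divDiff_mul_insert (f : F → F) {a : F} {Z : Finset F} (ha : a ∉ Z) :
    divDiff (fun x => x * f x) (insert a Z) = a * divDiff f (insert a Z) + divDiff f Z := by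
  rw [← divDiff_sub_mul_insert f ha, ← divDiff_const_mul, ← divDiff_add]
  congr 1
  ext x
  ring

theorem divDiff_insert_sub (f : F → F) {x y : F} {X : Finset F} (hx : x ∉ X) (hy : y ∉ X)
    (hxy : x ≠ y) :
    divDiff f (insert x X) - divDiff f (insert y X) =
      (x - y) * divDiff f (insert x (insert y X)) := by
  have h1 : y ∉ insert x X := by simp [hy, hxy.symm]
  have h2 : x ∉ insert y X := by simp [hx, hxy]
  rw [← divDiff_sub_mul_insert f h1, ← divDiff_sub_mul_insert f h2, Finset.insert_comm y x,
    ← divDiff_sub, ← divDiff_const_mul]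
  congr 1
  ext z
  ring

theorem divDiff_eval {P : Polynomial F} {Z : Finset F} (hP : P.degree < Z.card) :
    divDiff (fun x => P.eval x) Z = P.coeff (Z.card - 1) := by
  rw [Lagrange.coeff_eq_sum (v := id) (s := Z) (Set.injOn_id _) hP]
  refine Finset.sum_congr rfl fun x _ => ?_
  simp [div_eq_mul_inv, Finset.prod_inv_distrib]

theorem divDiff_pow_card_sub_one {n : ℕ} {Z : Finset F} (hZ : Z.card = n + 1) :
    divDiff (fun x => x ^ n) Z = 1 := by
  have h := divDiff_eval (P := (Polynomial.X : Polynomial F) ^ n) (Z := Z) (by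
    rw [Polynomial.degree_X_pow, hZ]; exact_mod_cast Nat.lt_succ_self n)
  simpa [hZ] using h

/-- A function whose divided differences of order `k` vanish agrees with its interpolation
polynomial at any `k` points. -/
theorem eq_eval_of_divDiff_eq_zero {f : F → F} {Z : Finset F}
    (h : ∀ x ∉ Z, divDiff f (insert x Z) = 0) :
    ∃ P : Polynomial F, P.degree < Z.card ∧ ∀ x, f x = P.eval x := by
  set P := Lagrange.interpolate Z id f with hPdef
  have hdeg : P.degree < Z.card := Lagrange.degree_interpolate_lt _ (Set.injOn_id _)
  have hnode : ∀ x ∈ Z, f x = P.eval x := fun x hx =>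
    (Lagrange.eval_interpolate_at_node (v := id) f (Set.injOn_id _) hx).symm
  refine ⟨P, hdeg, fun x => ?_⟩
  by_cases hx : x ∈ Z
  · exact hnode x hx
  have hP0 : divDiff (fun x => P.eval x) (insert x Z) = 0 := by
    rw [divDiff_eval, Finset.card_insert_of_notMem hx]
    · exact Polynomial.coeff_eq_zero_of_degree_lt (by simpa using hdeg)
    · rw [Finset.card_insert_of_notMem hx]
      exact hdeg.trans (by exact_mod_cast Nat.lt_succ_self _)
  have h0 : divDiff (fun x => f x - P.eval x) (insert x Z) = 0 := by
    rw [divDiff_sub, h x hx, hP0, sub_zero]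
  unfold divDiff at h0
  rw [Finset.sum_insert hx, Finset.sum_eq_zero (s := Z), add_zero] at h0
  · rcases mul_eq_zero.mp h0 with h0 | h0
    · exact sub_eq_zero.mp h0
    · obtain ⟨y, hy, hy0⟩ := Finset.prod_eq_zero_iff.mp h0
      exact absurd (sub_eq_zero.mp (inv_eq_zero.mp hy0)).symm (Finset.ne_of_mem_erase hy)
  · intro z hz
    simp only [hnode z hz, sub_self, zero_mul]

end DividedDifference

/-! ### Complete symmetric polynomials as divided differences. -/

section CompleteSymmetric

open Finset

/-- The value of the complete symmetric polynomial of degree `n` at the point `v`. -/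
def completeSymmetricValue {R σ : Type*} [CommSemiring R] [Fintype σ] [DecidableEq σ]
    (v : σ → R) (n : ℕ) : R :=
  ∑ s : Sym σ n, ((s : Multiset σ).map v).prod

theorem completeSymmetricValue_option {R : Type*} [CommSemiring R] {α : Type*} [Fintype α]
    [DecidableEq α] (v : Option α → R) (n : ℕ) :
    completeSymmetricValue v (n + 1) = v none * completeSymmetricValue v n +
      completeSymmetricValue (fun i => v (some i)) (n + 1) := by
  unfold completeSymmetricValue
  rw [← Equiv.sum_comp (symOptionSuccEquiv (α := α) (n := n)).symm, Fintype.sum_sum_type, mul_sum]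
  congr 1
  · refine sum_congr rfl fun s _ => ?_
    change ((SymOptionSuccEquiv.decode (Sum.inl s) : Multiset (Option α)).map v).prod = _
    rw [SymOptionSuccEquiv.decode_inl, Sym.coe_cons, Multiset.map_cons, Multiset.prod_cons]
  · refine sum_congr rfl fun s _ => ?_
    change ((SymOptionSuccEquiv.decode (Sum.inr s) : Multiset (Option α)).map v).prod = _
    simp

theorem completeSymmetricValue_equiv {R σ τ : Type*} [CommSemiring R] [Fintype σ] [DecidableEq σ]
    [Fintype τ] [DecidableEq τ] (e : σ ≃ τ) (v : τ → R) (n : ℕ) :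
    completeSymmetricValue (fun i => v (e i)) n = completeSymmetricValue v n := by
  unfold completeSymmetricValue
  refine Fintype.sum_equiv (Sym.equivCongr e) _ _ fun s => ?_
  simp

theorem completeSymmetricValue_fin_succ {R : Type*} [CommSemiring R] {k : ℕ}
    (v : Fin (k + 1) → R) (n : ℕ) :
    completeSymmetricValue v (n + 1) = v 0 * completeSymmetricValue v n +
      completeSymmetricValue (fun i => v (Fin.succ i)) (n + 1) := by
  rw [← completeSymmetricValue_equiv (finSuccEquiv k).symm v,
    ← completeSymmetricValue_equiv (finSuccEquiv k).symm v,
    completeSymmetricValue_option]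
  simp

theorem completeSymmetricValue_zero {R σ : Type*} [CommSemiring R] [Fintype σ] [DecidableEq σ]
    (v : σ → R) : completeSymmetricValue v 0 = 1 := by
  simp [completeSymmetricValue, Sym.eq_nil_of_card_zero]

/-- The complete symmetric polynomials are divided differences of powers. -/
theorem completeSymmetricValue_eq_divDiff {F : Type*} [Field F] [DecidableEq F] (k : ℕ) :
    ∀ (v : Fin k → F), Function.Injective v → ∀ e n : ℕ, n + 1 = k + e →
      completeSymmetricValue v e = divDiff (fun x => x ^ n) (univ.image v) := by
  induction k with
  | zero =>
    intro v _ e n hn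
    obtain rfl : e = n + 1 := by omega
    have : IsEmpty (Sym (Fin 0) (n + 1)) := inferInstance
    simp [completeSymmetricValue, divDiff]
  | succ k ih =>
    intro v hv e
    have hins : univ.image v = insert (v 0) (univ.image fun i => v (Fin.succ i)) := by
      ext x
      simp [Fin.exists_fin_succ, eq_comm]
    have hnot : v 0 ∉ univ.image fun i => v (Fin.succ i) := by
      simp [hv.eq_iff]
    induction e with
    | zero =>
      intro n hn
      rw [completeSymmetricValue_zero, divDiff_pow_card_sub_one]
      rw [card_image_of_injective _ hv, card_univ, Fintype.card_fin]
      omega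
    | succ e ihe =>
      intro n hn
      obtain ⟨m, rfl⟩ : ∃ m, n = m + 1 := ⟨k + e, by omega⟩
      -- Both sides obey one recursion: splitting monomials by whether they contain `v 0` matches
      -- `divDiff_mul_insert`.
      rw [completeSymmetricValue_fin_succ, ihe m (by omega),
        ih (fun i => v i.succ) (hv.comp (Fin.succ_injective k)) (e + 1) m (by omega), hins,
        ← divDiff_mul_insert _ hnot]
      simp only [pow_succ']

theorem eval_hsymm {R σ : Type*} [CommSemiring R] [Fintype σ] [DecidableEq σ]
    (v : σ → R) (n : ℕ) :
    MvPolynomial.eval v (MvPolynomial.hsymm σ R n) = completeSymmetricValue v n := by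
  simp only [MvPolynomial.hsymm, completeSymmetricValue, map_sum, map_multiset_prod,
    Multiset.map_map, Function.comp_def, MvPolynomial.eval_X]
  rfl

theorem divDiff_sum {F ι : Type*} [Field F] [DecidableEq F] (s : Finset ι) (f : ι → F → F)
    (Z : Finset F) : divDiff (fun x => ∑ i ∈ s, f i x) Z = ∑ i ∈ s, divDiff (f i) Z := by
  simp only [divDiff, sum_mul]
  exact sum_comm

/-- Reduction modulo `x^q - x` does not change values on `F`, and divided differences depend only on
values. -/
theorem eval_completeSymmetric {F : Type*} [Field F] [Fintype F] [DecidableEq F] {k : ℕ}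
    (hk : 0 < k) (m : ℕ) (a : ℕ → F) {v : Fin k → F} (hv : Function.Injective v) :
    MvPolynomial.eval v (completeSymmetric F k m a) =
      divDiff (fun x => (associatedReduction F k m a).eval x) (univ.image v) := by
  have hred : ∀ x : F, (associatedReduction F k m a).eval x =
      ∑ e ∈ range (m + 1), a e * x ^ (k - 1 + e) := by
    intro x
    have hmonic : (Polynomial.X ^ Fintype.card F - Polynomial.X : Polynomial F).Monic := by
      refine Polynomial.monic_X_pow_sub ?_
      rw [Polynomial.degree_X]
      exact_mod_cast Fintype.one_lt_card
    have h := congrArg (Polynomial.eval x) (Polynomial.modByMonic_add_div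
      (Polynomial.X ^ (k - 1) * ∑ e ∈ range (m + 1), Polynomial.C (a e) * Polynomial.X ^ e)
      (Polynomial.X ^ Fintype.card F - Polynomial.X))
    rw [Polynomial.eval_add, Polynomial.eval_mul, Polynomial.eval_sub, Polynomial.eval_pow,
      Polynomial.eval_X, FiniteField.pow_card, sub_self, zero_mul, add_zero] at h
    rw [associatedReduction, h, Polynomial.eval_mul, Polynomial.eval_finsetSum, mul_sum]
    refine sum_congr rfl fun e _ => ?_
    simp only [Polynomial.eval_mul, Polynomial.eval_pow, Polynomial.eval_X, Polynomial.eval_C]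
    ring
  simp only [hred]
  rw [divDiff_sum, completeSymmetric, map_sum]
  refine sum_congr rfl fun e _ => ?_
  rw [divDiff_const_mul, map_mul, MvPolynomial.eval_C, eval_hsymm,
    completeSymmetricValue_eq_divDiff k v hv e (k - 1 + e) (by omega)]

end CompleteSymmetric

/-! ### Sums and products from large subsets; secants of a conic. -/

section PairsAndTriples

open Finset

variable {F : Type*} [Field F] [Fintype F] [DecidableEq F]

/-- A map sending more than half of `B` into `B` injectively sends some element of a large subset
`A` to a different element of `A`. -/
theorem exists_mem_map_mem_ne {α : Type*} [DecidableEq α] {A B T : Finset α} {σ : α → α}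
    (hAB : A ⊆ B) (hσ : ∀ a ∈ A, σ a ∈ B) (hinj : Set.InjOn σ A)
    (hfix : ∀ a ∈ A, σ a = a → a ∈ T) (hcard : B.card + T.card < 2 * A.card) :
    ∃ a ∈ A, σ a ∈ A ∧ σ a ≠ a := by
  have h1 : (A.image σ).card = A.card := card_image_of_injOn hinj
  have h2 : A ∪ A.image σ ⊆ B := union_subset hAB (image_subset_iff.mpr hσ)
  have h3 := card_le_card h2
  have h4 := card_union_add_card_inter A (A.image σ)
  have h5 : T.card < (A ∩ A.image σ).card := by omega
  obtain ⟨b, hb, hbT⟩ := exists_mem_notMem_of_card_lt_card h5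
  obtain ⟨hbA, hbσ⟩ := mem_inter.mp hb
  obtain ⟨a, ha, rfl⟩ := mem_image.mp hbσ
  refine ⟨a, ha, hbA, fun h => hbT ?_⟩
  rw [h]
  exact hfix a ha h

/-- Pigeonhole for the involution `x ↦ s - x`, whose only fixed point is `s / 2`. -/
theorem exists_add_eq_of_two_ne_zero (h2 : (2 : F) ≠ 0) {A : Finset F} (s : F)
    (hA : Fintype.card F + 1 < 2 * A.card) : ∃ a ∈ A, ∃ b ∈ A, a ≠ b ∧ a + b = s := by
  obtain ⟨a, ha, hb, hne⟩ := exists_mem_map_mem_ne (A := A) (B := univ) (T := {s / 2})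
    (σ := fun x => s - x) (subset_univ _) (fun _ _ => mem_univ _)
    (sub_right_injective.injOn) (fun a _ h => by
      rw [mem_singleton, eq_div_iff h2]; linear_combination -h) (by simpa using hA)
  exact ⟨a, ha, s - a, hb, hne.symm, by ring⟩

theorem exists_add_eq_of_two_eq_zero (h2 : (2 : F) = 0) {A : Finset F} {s : F} (hs : s ≠ 0)
    (hA : Fintype.card F < 2 * A.card) : ∃ a ∈ A, ∃ b ∈ A, a ≠ b ∧ a + b = s := by
  obtain ⟨a, ha, hb, hne⟩ := exists_mem_map_mem_ne (A := A) (B := univ) (T := ∅)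
    (σ := fun x => s - x) (subset_univ _) (fun _ _ => mem_univ _)
    (sub_right_injective.injOn) (fun a _ h => by
      exact absurd (by linear_combination h + a * h2) hs) (by simpa using hA)
  exact ⟨a, ha, s - a, hb, hne.symm, by ring⟩

/-- `A` has more than `(q + 4) / 2` elements for odd `q`, or at least that many for even `q`. -/
def IsLargeSubset (A : Finset F) : Prop :=
  ((2 : F) ≠ 0 ∧ Fintype.card F + 5 ≤ 2 * A.card) ∨
    ((2 : F) = 0 ∧ Fintype.card F + 4 ≤ 2 * A.card)

theorem IsLargeSubset.exists_add_add_eq {A : Finset F} (hA : IsLargeSubset A) (s : F) :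
    ∃ a ∈ A, ∃ b ∈ A, ∃ c ∈ A, a ≠ b ∧ a ≠ c ∧ b ≠ c ∧ a + b + c = s := by
  suffices h : ∃ a ∈ A, ∃ b ∈ A.erase a, ∃ c ∈ A.erase a, b ≠ c ∧ b + c = s - a by
    obtain ⟨a, ha, b, hb, c, hc, hbc, h⟩ := h
    exact ⟨a, ha, b, mem_of_mem_erase hb, c, mem_of_mem_erase hc, (ne_of_mem_erase hb).symm,
      (ne_of_mem_erase hc).symm, hbc, by linear_combination h⟩
  rcases hA with ⟨h2, hA⟩ | ⟨h2, hA⟩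
  · obtain ⟨a, ha⟩ : A.Nonempty := card_pos.mp (by omega)
    refine ⟨a, ha, exists_add_eq_of_two_ne_zero h2 (s - a) ?_⟩
    rw [card_erase_of_mem ha]
    omega
  · obtain ⟨a, ha, has⟩ : ∃ a ∈ A, a ≠ s := by
      have hq := Fintype.card_pos (α := F)
      exact exists_mem_ne (by omega) s
    refine ⟨a, ha, exists_add_eq_of_two_eq_zero h2 (sub_ne_zero.mpr has.symm) ?_⟩
    rw [card_erase_of_mem ha]
    omega

/-- `a * b = δ` is solvable with distinct elements of a large set, when `δ ≠ 0`. -/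
theorem IsLargeSubset.exists_mul_eq {A : Finset F} (hA : IsLargeSubset A) (y : F) {δ : F}
    (hδ : δ ≠ 0) : ∃ a ∈ A, ∃ b ∈ A, a ≠ b ∧ (a - y) * (b - y) = δ := by
  -- Translate by `y`, drop `0`, and pair `u` with `δ / u`. The fixed points are the square roots of
  -- `δ`: at most two, and at most one in characteristic 2.
  have key : ∀ T : Finset F, (∀ u : F, u * u = δ → u ∈ T) →
      Fintype.card F - 1 + T.card < 2 * (A.card - 1) →
      ∃ a ∈ A, ∃ b ∈ A, a ≠ b ∧ (a - y) * (b - y) = δ := by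
    intro T hT hcard
    set A' := (A.image fun a => a - y).erase 0 with hA'
    have hc : A.card - 1 ≤ A'.card := by
      have := pred_card_le_card_erase (s := A.image fun a => a - y) (a := 0)
      rwa [card_image_of_injective _ (sub_left_injective)] at this
    have h0 : ∀ u ∈ A', u ≠ 0 := fun u hu => ne_of_mem_erase hu
    have hmem : ∀ u ∈ A', u + y ∈ A := by
      intro u hu
      obtain ⟨a, ha, rfl⟩ := mem_image.mp (mem_of_mem_erase hu)
      simpa using ha
    obtain ⟨u, hu, hv, hne⟩ := exists_mem_map_mem_ne (A := A') (B := univ.erase 0) (T := T)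
      (σ := fun x => δ / x) (fun u hu => mem_erase.mpr ⟨h0 u hu, mem_univ _⟩)
      (fun u hu => mem_erase.mpr ⟨div_ne_zero hδ (h0 u hu), mem_univ _⟩)
      (fun u hu v hv h => by
        have hu := h0 u hu
        have hv := h0 v hv
        field_simp at h
        exact h.symm)
      (fun u hu h => hT u (by
        have hu := h0 u hu
        field_simp at h
        rw [h]; ring)) (by
        rw [card_erase_of_mem (mem_univ _), card_univ]
        omega)
    refine ⟨u + y, hmem u hu, δ / u + y, hmem _ hv, fun h => hne (add_right_cancel h).symm, ?_⟩
    have := h0 u hu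
    field_simp
    ring
  have hq := Fintype.card_pos (α := F)
  by_cases hroot : ∃ w : F, w * w = δ
  · obtain ⟨w, hw⟩ := hroot
    have hT : ∀ u : F, u * u = δ → u = w ∨ u = -w := fun u hu =>
      mul_self_eq_mul_self_iff.mp (hu.trans hw.symm)
    rcases hA with ⟨h2, hA⟩ | ⟨h2, hA⟩
    · refine key {w, -w} (fun u hu => by simpa using hT u hu) ?_
      have := card_le_two (a := w) (b := -w)
      omega
    · refine key {w} (fun u hu => ?_) ?_
      · rcases hT u hu with h | h
        · simpa using h
        · rw [mem_singleton, h]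
          linear_combination -w * h2
      · rw [card_singleton]
        omega
  · refine key ∅ (fun u hu => absurd ⟨u, hu⟩ hroot) ?_
    rcases hA with ⟨h2, hA⟩ | ⟨h2, hA⟩ <;> simp <;> omega

/-- The points of the plane lying on no secant of a large subset of a conic: they lie on the conic,
or they are the nucleus. -/
theorem IsLargeSubset.conic_or_nucleus {D : Finset F} (hD : IsLargeSubset D) {α β γ : F}
    (h : ∀ a ∈ D, ∀ b ∈ D, a ≠ b → γ - (a + b) * β + a * b * α ≠ 0) :
    (α ≠ 0 ∧ α * γ = β ^ 2) ∨ (α = 0 ∧ β = 0) ∨ ((2 : F) = 0 ∧ α = 0 ∧ γ = 0) := by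
  by_cases hα : α = 0
  · right
    by_cases hβ : β = 0
    · exact Or.inl ⟨hα, hβ⟩
    right
    subst hα
    have hno : ¬ ∃ a ∈ D, ∃ b ∈ D, a ≠ b ∧ a + b = γ / β := by
      rintro ⟨a, ha, b, hb, hab, hs⟩
      refine h a ha b hb hab ?_
      rw [hs]
      field_simp
      ring
    rcases hD with ⟨h2, hD⟩ | ⟨h2, hD⟩
    · exact absurd (exists_add_eq_of_two_ne_zero h2 _ (by omega)) hno
    · refine ⟨h2, rfl, ?_⟩
      by_contra hγ
      exact hno (exists_add_eq_of_two_eq_zero h2 (div_ne_zero hγ hβ) (by omega))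
  · left
    refine ⟨hα, ?_⟩
    by_contra hne
    -- With `δ` this quantity, the secant form is `α * ((a - β/α) * (b - β/α) - δ)`.
    have hδ : (β / α) ^ 2 - γ / α ≠ 0 := by
      intro h0
      apply hne
      field_simp at h0
      linear_combination -h0
    obtain ⟨a, ha, b, hb, hab, heq⟩ := hD.exists_mul_eq (β / α) hδ
    refine h a ha b hb hab ?_
    field_simp at heq
    have : α * (γ - (a + b) * β + a * b * α) = 0 := by linear_combination heq
    exact (mul_eq_zero.mp this).resolve_left hα

end PairsAndTriples

/-! ### Large `k`: excluding the conic and the nucleus. -/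

section HighDimension

open Finset

variable {F : Type*} [Field F] [DecidableEq F]

theorem divDiff_erase (f : F → F) {a : F} {Z : Finset F} (ha : a ∈ Z) :
    divDiff f (Z.erase a) = divDiff (fun x => x * f x) Z - a * divDiff f Z := by
  have h := divDiff_mul_insert f (notMem_erase a Z)
  rw [insert_erase ha] at h
  linear_combination -h

theorem divDiff_erase_erase (f : F → F) {a b : F} {Z : Finset F} (ha : a ∈ Z) (hb : b ∈ Z)
    (hab : a ≠ b) :
    divDiff f ((Z.erase a).erase b) =
      divDiff (fun x => x * (x * f x)) Z - (a + b) * divDiff (fun x => x * f x) Z +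
        a * b * divDiff f Z := by
  rw [divDiff_erase f (mem_erase.mpr ⟨hab.symm, hb⟩), divDiff_erase _ ha, divDiff_erase _ ha]
  ring

theorem divDiff_erase_erase_erase (f : F → F) {a b c : F} {Z : Finset F} (ha : a ∈ Z)
    (hb : b ∈ Z) (hc : c ∈ Z) (hab : a ≠ b) (hac : a ≠ c) (hbc : b ≠ c) :
    divDiff f (((Z.erase a).erase b).erase c) =
      divDiff (fun x => x * (x * (x * f x))) Z -
        (a + b + c) * divDiff (fun x => x * (x * f x)) Z +
        (a * b + a * c + b * c) * divDiff (fun x => x * f x) Z - a * b * c * divDiff f Z := by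
  rw [divDiff_erase f (mem_erase.mpr ⟨hbc.symm, mem_erase.mpr ⟨hac.symm, hc⟩⟩),
    divDiff_erase_erase _ ha hb hab, divDiff_erase_erase _ ha hb hab]
  ring

variable [Fintype F]

theorem conic_or_nucleus_of_divDiff_ne_zero {f : F → F} {k : ℕ}
    (hf : ∀ Z : Finset F, Z.card = k → divDiff f Z ≠ 0) {D : Finset F} (hD : IsLargeSubset D)
    (hcard : D.card = k + 2) :
    (divDiff f D ≠ 0 ∧
        divDiff f D * divDiff (fun x => x * (x * f x)) D = divDiff (fun x => x * f x) D ^ 2) ∨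
      (divDiff f D = 0 ∧ divDiff (fun x => x * f x) D = 0) ∨
      ((2 : F) = 0 ∧ divDiff f D = 0 ∧ divDiff (fun x => x * (x * f x)) D = 0) := by
  refine hD.conic_or_nucleus fun a ha b hb hab => ?_
  rw [← divDiff_erase_erase f ha hb hab]
  apply hf
  rw [card_erase_of_mem (mem_erase.mpr ⟨hab.symm, hb⟩), card_erase_of_mem ha]
  omega

/-- A conic point with `α ≠ 0` has parameter `y = β / α`. If `y ∈ D`, deleting `y` and another node
gives zero. If not, adjoining `y` and deleting three suitable nodes does. -/
theorem not_conic_of_divDiff_ne_zero {f : F → F} {k : ℕ}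
    (hf : ∀ Z : Finset F, Z.card = k → divDiff f Z ≠ 0) {D : Finset F} (hD : IsLargeSubset D)
    (hcard : D.card = k + 2) (hα : divDiff f D ≠ 0) :
    divDiff f D * divDiff (fun x => x * (x * f x)) D ≠ divDiff (fun x => x * f x) D ^ 2 := by
  intro hconic
  set α := divDiff f D with hαdef
  set β := divDiff (fun x => x * f x) D with hβdef
  set γ := divDiff (fun x => x * (x * f x)) D with hγdef
  obtain ⟨y, hy⟩ : ∃ y, β = y * α := ⟨β / α, by field_simp⟩
  have hγ : γ = y ^ 2 * α := by
    apply mul_left_cancel₀ hα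
    rw [hconic, hy]
    ring
  have hyD : y ∉ D := by
    intro hyD
    obtain ⟨b, hb, hby⟩ : ∃ b ∈ D, b ≠ y := exists_mem_ne (by omega) y
    refine hf ((D.erase y).erase b) ?_ ?_
    · rw [card_erase_of_mem (mem_erase.mpr ⟨hby, hb⟩), card_erase_of_mem hyD]
      omega
    · rw [divDiff_erase_erase f hyD hb hby.symm, ← hαdef, ← hβdef, ← hγdef, hγ, hy]
      ring
  have e1 := divDiff_mul_insert f hyD
  have e2 := divDiff_mul_insert (fun x => x * f x) hyD
  have e3 := divDiff_mul_insert (fun x => x * (x * f x)) hyD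
  rw [← hαdef] at e1
  rw [← hβdef] at e2
  rw [← hγdef] at e3
  set c := divDiff f (insert y D) with hc
  have hinj : Set.InjOn (fun a => (y - a)⁻¹) (D : Set F) := fun a _ b _ h => by
    simpa using h
  have hlarge : IsLargeSubset (D.image fun a => (y - a)⁻¹) := by
    unfold IsLargeSubset
    rw [card_image_of_injOn hinj]
    exact hD
  -- With `P = (T - a)(T - b)(T - d)`, the difference after deleting `a, b, d` is `c P(y) + α
  -- P'(y)`; it vanishes when `P'(y) / P(y) = -c / α`.
  obtain ⟨u, hu, v, hv, w, hw, huv, huw, hvw, hsum⟩ := hlarge.exists_add_add_eq (-c / α)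
  obtain ⟨a, ha, rfl⟩ := mem_image.mp hu
  obtain ⟨b, hb, rfl⟩ := mem_image.mp hv
  obtain ⟨d, hd, rfl⟩ := mem_image.mp hw
  have hab : a ≠ b := fun h => huv (by rw [h])
  have had : a ≠ d := fun h => huw (by rw [h])
  have hbd : b ≠ d := fun h => hvw (by rw [h])
  have hya : y - a ≠ 0 := sub_ne_zero.mpr fun h => hyD (h ▸ ha)
  have hyb : y - b ≠ 0 := sub_ne_zero.mpr fun h => hyD (h ▸ hb)
  have hyd : y - d ≠ 0 := sub_ne_zero.mpr fun h => hyD (h ▸ hd)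
  have ha' := mem_insert_of_mem (b := y) ha
  have hb' := mem_insert_of_mem (b := y) hb
  have hd' := mem_insert_of_mem (b := y) hd
  refine hf ((((insert y D).erase a).erase b).erase d) ?_ ?_
  · rw [card_erase_of_mem (mem_erase.mpr ⟨hbd.symm, mem_erase.mpr ⟨had.symm, hd'⟩⟩),
      card_erase_of_mem (mem_erase.mpr ⟨hab.symm, hb'⟩), card_erase_of_mem ha',
      card_insert_of_notMem hyD]
    omega
  · rw [divDiff_erase_erase_erase f ha' hb' hd' hab had hbd, e3, e2, e1, ← hc, hγ, hy]
    field_simp at hsum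
    linear_combination hsum

/-- Exchange a node `s` of `D` for an outside point `t`. If `β ≠ 0`, the new vector must be on the
conic with nonzero first coordinate, which forces `(t - s)² c = β`. In characteristic 2 this cannot
hold for two values of `s`. -/
theorem not_nucleus_of_divDiff_ne_zero {f : F → F} {k : ℕ}
    (hf : ∀ Z : Finset F, Z.card = k → divDiff f Z ≠ 0)
    (hlarge : ∀ D : Finset F, D.card = k + 2 → IsLargeSubset D)
    (hk : k + 3 ≤ Fintype.card F) (h2 : (2 : F) = 0) {D : Finset F} (hcard : D.card = k + 2)
    (hα : divDiff f D = 0) (hγ : divDiff (fun x => x * (x * f x)) D = 0) :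
    divDiff (fun x => x * f x) D = 0 := by
  by_contra hβ
  obtain ⟨t, ht⟩ : ∃ t, t ∉ D := by
    by_contra! h
    have : D = univ := eq_univ_of_forall h
    rw [this, card_univ] at hcard
    omega
  have e1 := divDiff_mul_insert f ht
  have e2 := divDiff_mul_insert (fun x => x * f x) ht
  have e3 := divDiff_mul_insert (fun x => x * (x * f x)) ht
  set β := divDiff (fun x => x * f x) D with hβdef
  rw [hα, add_zero] at e1
  rw [hγ, add_zero] at e3
  set c := divDiff f (insert t D) with hc
  have key : ∀ s ∈ D, (t - s) ^ 2 * c = β := by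
    intro s hs
    have hst : t - s ≠ 0 := sub_ne_zero.mpr fun h => ht (h ▸ hs)
    have hs' := mem_insert_of_mem (b := t) hs
    have hcard' : ((insert t D).erase s).card = k + 2 := by
      rw [card_erase_of_mem hs', card_insert_of_notMem ht]
      omega
    have hcases := conic_or_nucleus_of_divDiff_ne_zero hf (hlarge _ hcard') hcard'
    rw [divDiff_erase _ hs', divDiff_erase _ hs', divDiff_erase _ hs', e3, e2, e1, ← hc] at hcases
    rcases hcases with ⟨-, h⟩ | ⟨h, h'⟩ | ⟨-, h, h'⟩
    · apply mul_right_cancel₀ hβ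
      linear_combination h + β * t * (t - s) * c * h2
    · have hc0 : c = 0 := by
        have : (t - s) * c = 0 := by linear_combination h
        exact (mul_eq_zero.mp this).resolve_left hst
      rw [hc0] at h'
      exact absurd (by linear_combination h') hβ
    · have hc0 : c = 0 := by
        have : (t - s) * c = 0 := by linear_combination h
        exact (mul_eq_zero.mp this).resolve_left hst
      rw [hc0] at h'
      have : (t - s) * β = 0 := by linear_combination h'
      exact absurd ((mul_eq_zero.mp this).resolve_left hst) hβ
  obtain ⟨a, ha, b, hb, hab⟩ : ∃ a ∈ D, ∃ b ∈ D, a ≠ b := one_lt_card.mp (by omega)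
  have hc0 : c ≠ 0 := by
    intro h0
    have := key a ha
    rw [h0, mul_zero] at this
    exact hβ this.symm
  have hsq : (a - b) ^ 2 * c = 0 := by
    linear_combination key a ha - key b hb + (a - b) * (t - b) * c * h2
  have := (mul_eq_zero.mp hsq).resolve_right hc0
  exact hab (sub_eq_zero.mp (pow_eq_zero_iff two_ne_zero |>.mp this))

/-- Half of the classification of deep holes of Reed-Solomon codes: the high dimensional case. -/
theorem divDiff_eq_zero_of_large {f : F → F} {k : ℕ}
    (hf : ∀ Z : Finset F, Z.card = k → divDiff f Z ≠ 0)
    (hlarge : ∀ D : Finset F, D.card = k + 2 → IsLargeSubset D)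
    (hk : k + 2 ≤ Fintype.card F) (hk2 : (2 : F) = 0 → k + 3 ≤ Fintype.card F)
    {Z : Finset F} (hZ : Z.card = k + 1) : divDiff f Z = 0 := by
  obtain ⟨t, ht⟩ : ∃ t, t ∉ Z := by
    by_contra! h
    have : Z = univ := eq_univ_of_forall h
    rw [this, card_univ] at hZ
    omega
  have hcard : (insert t Z).card = k + 2 := by rw [card_insert_of_notMem ht, hZ]
  have h : divDiff f (insert t Z) = 0 ∧ divDiff (fun x => x * f x) (insert t Z) = 0 := by
    rcases conic_or_nucleus_of_divDiff_ne_zero hf (hlarge _ hcard) hcard with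
      ⟨hα, h⟩ | h | ⟨h2, hα, hγ⟩
    · exact absurd h (not_conic_of_divDiff_ne_zero hf (hlarge _ hcard) hcard hα)
    · exact h
    · exact ⟨hα, not_nucleus_of_divDiff_ne_zero hf hlarge (hk2 h2) h2 hcard hα hγ⟩
  have := divDiff_mul_insert f ht
  rw [h.1, h.2] at this
  linear_combination -this

end HighDimension

/-! ### Injectivity of an inclusion matrix. -/

section InclusionMatrix

open Finset

variable {α F : Type*} [DecidableEq α] [Field F]

/-- The sum of `U` over the `n`-subsets of `E` containing `A` and disjoint from `B`. -/
def sumBetween (U : Finset α → F) (n : ℕ) (E A B : Finset α) : F :=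
  ∑ C ∈ powersetCard n (E \ B) with A ⊆ C, U C

theorem sumBetween_insert_right (U : Finset α → F) (n : ℕ) (E A : Finset α) {B : Finset α} (b : α) :
    sumBetween U n E A B = sumBetween U n E A (insert b B) + sumBetween U n E (insert b A) B := by
  unfold sumBetween
  rw [← sum_filter_add_sum_filter_not _ (fun C => b ∉ C)]
  congr 1
  · refine sum_congr ?_ fun _ _ => rfl
    ext C
    simp only [mem_filter, mem_powersetCard, subset_iff, mem_sdiff, mem_insert]
    grind
  · refine sum_congr ?_ fun _ _ => rfl
    ext C
    simp only [mem_filter, mem_powersetCard, subset_iff, mem_sdiff, mem_insert]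
    grind

theorem sumBetween_eq_apply (U : Finset α → F) {E A : Finset α} (hA : A ⊆ E) :
    sumBetween U A.card E A ∅ = U A := by
  unfold sumBetween
  rw [sum_eq_single_of_mem A]
  · simpa using hA
  · intro C hC hne
    simp only [mem_filter, mem_powersetCard] at hC
    exact absurd (eq_of_subset_of_card_le hC.2 hC.1.2.le).symm hne

theorem sum_sumBetween_insert (U : Finset α → F) (n : ℕ) (E A : Finset α) :
    ∑ y ∈ E \ A, sumBetween U n E (insert y A) ∅ =
      ((n - A.card : ℕ) : F) * sumBetween U n E A ∅ := by
  unfold sumBetween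
  rw [sum_comm' (t' := {C ∈ powersetCard n (E \ ∅) | A ⊆ C}) (s' := fun C => C \ A), mul_sum]
  · refine sum_congr rfl fun C hC => ?_
    simp only [mem_filter, mem_powersetCard] at hC
    rw [sum_const, nsmul_eq_mul, card_sdiff_of_subset hC.2, hC.1.2]
  · intro y C
    simp only [mem_filter, mem_powersetCard, subset_iff, mem_sdiff, mem_insert]
    grind

/-- The inclusion matrix of `(n-1)`-subsets in `n`-subsets of a set with fewer than `2n` elements
has trivial kernel when `n!` is invertible. -/
theorem eq_zero_of_sum_insert_eq_zero {n : ℕ} {E : Finset α} (hE : E.card < 2 * n)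
    (hchar : ∀ j : ℕ, 0 < j → j ≤ n → (j : F) ≠ 0) {U : Finset α → F}
    (h : ∀ X ⊆ E, X.card + 1 = n → ∑ y ∈ E \ X, U (insert y X) = 0) {C : Finset α}
    (hC : C ⊆ E) (hCn : C.card = n) : U C = 0 := by
  -- Descend from `|A| = n - 1`: double counting introduces the factor `n - |A|`, which is
  -- invertible.
  have hdown : ∀ j : ℕ, ∀ A ⊆ E, A.card + (j + 1) = n → sumBetween U n E A ∅ = 0 := by
    intro j
    induction j with
    | zero =>
      intro A hA hcard
      have h1 := sum_sumBetween_insert U n E A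
      rw [show n - A.card = 1 by omega, Nat.cast_one, one_mul] at h1
      rw [← h1, ← h A hA (by omega)]
      refine sum_congr rfl fun y hy => ?_
      obtain ⟨hyE, hyA⟩ := mem_sdiff.mp hy
      have hc : (insert y A).card = n := by rw [card_insert_of_notMem hyA]; omega
      have := sumBetween_eq_apply U (insert_subset hyE hA)
      rwa [hc] at this
    | succ j ih =>
      intro A hA hcard
      have h1 := sum_sumBetween_insert U n E A
      rw [sum_eq_zero] at h1
      · exact (mul_eq_zero.mp h1.symm).resolve_left (hchar _ (by omega) (by omega))
      · intro y hy
        obtain ⟨hyE, hyA⟩ := mem_sdiff.mp hy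
        exact ih _ (insert_subset hyE hA) (by rw [card_insert_of_notMem hyA]; omega)
  -- Each excluded element can be traded for an included one at the cost of a sign. Trading all of
  -- `C` compares `U C` with an empty sum, since `E \ C` has fewer than `n` elements.
  have hmove : ∀ B : Finset α, B ⊆ E → ∀ A ⊆ E, Disjoint A B → A.card + B.card ≤ n →
      sumBetween U n E A B = (-1) ^ B.card * sumBetween U n E (A ∪ B) ∅ := by
    intro B
    induction B using Finset.induction_on with
    | empty => intro _ A _ _ _; simp
    | insert b B hb ih =>
      intro hBE A hA hdisj hcard
      rw [card_insert_of_notMem hb] at hcard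
      obtain ⟨hbE, hBE⟩ := insert_subset_iff.mp hBE
      rw [disjoint_insert_right] at hdisj
      have h1 := sumBetween_insert_right U n E A (B := B) b
      have hdisj' : Disjoint (insert b A) B := disjoint_insert_left.mpr ⟨hb, hdisj.2⟩
      rw [ih hBE A hA hdisj.2 (by omega), ih hBE (insert b A) (insert_subset hbE hA) hdisj'
        (by rw [card_insert_of_notMem hdisj.1]; omega),
        hdown (n - (A ∪ B).card - 1) (A ∪ B) (union_subset hA hBE) (by
          rw [card_union_of_disjoint hdisj.2]; omega)] at h1
      rw [card_insert_of_notMem hb, union_insert, ← insert_union]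
      linear_combination -h1
  have h1 := hmove C hC ∅ (empty_subset _) (disjoint_empty_left _) (by simp [hCn])
  have h2 : sumBetween U n E ∅ C = 0 := by
    unfold sumBetween
    rw [powersetCard_eq_empty.mpr (by rw [card_sdiff_of_subset hC]; omega)]
    simp
  have h3 := sumBetween_eq_apply U hC
  rw [hCn] at h3
  rw [h2, empty_union, h3] at h1
  exact (mul_eq_zero.mp h1.symm).resolve_left (pow_ne_zero _ (by simp))

end InclusionMatrix

/-! ### Small `k`: the lemma of tangents. -/

section LowDimension

open Finset

variable {F : Type*} [Field F] [DecidableEq F]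

/-- Up to a factor independent of `y`, this weight is the coefficient in the tangent relation, so
weighting turns that relation into a plain inclusion sum. -/
theorem prod_cross_differences {X Y : Finset F} (hXY : Disjoint X Y) {y : F} (hy : y ∈ Y) :
    ∏ z ∈ Y.erase y, ∏ x ∈ insert y X, (x - z)⁻¹ =
      ((∏ z ∈ Y, ∏ x ∈ X, (x - z)⁻¹) * (-1) ^ X.card) *
        ((∏ x ∈ X, (y - x)) / ∏ z ∈ Y.erase y, (y - z)) := by
  have hyX : y ∉ X := fun h => disjoint_left.mp hXY h hy
  have hne : ∏ x ∈ X, (y - x) ≠ 0 := prod_ne_zero_iff.mpr fun x hx =>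
    sub_ne_zero.mpr fun h => hyX (h ▸ hx)
  have hneg : ∏ x ∈ X, (x - y)⁻¹ = (-1) ^ X.card * (∏ x ∈ X, (y - x))⁻¹ := by
    rw [prod_congr rfl fun x _ => show (x - y)⁻¹ = -(y - x)⁻¹ by rw [← inv_neg, neg_sub],
      prod_neg, prod_inv_distrib]
  simp only [prod_insert hyX, prod_mul_distrib]
  rw [← mul_prod_erase Y _ hy, hneg, prod_inv_distrib]
  have hs : ((-1 : F) ^ X.card) * (-1) ^ X.card = 1 := by
    rw [← mul_pow]; simp
  have hq := mul_inv_cancel₀ hne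
  rw [div_eq_mul_inv]
  generalize ∏ z ∈ Y.erase y, ∏ x ∈ X, (x - z)⁻¹ = A
  generalize (∏ z ∈ Y.erase y, (y - z))⁻¹ = B
  generalize ∏ x ∈ X, (y - x) = q at hq
  linear_combination (-A * B * q * q⁻¹) * hs - A * B * hq

variable [Fintype F]

/-- The product is the derivative of `X^q - X` at `x`. -/
theorem prod_erase_univ_sub (x : F) : ∏ y ∈ univ.erase x, (x - y) = -1 := by
  have hq : 1 < Fintype.card F := Fintype.one_lt_card
  have hnodal : Lagrange.nodal univ id =
      (Polynomial.X ^ Fintype.card F - Polynomial.X : Polynomial F) := by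
    have hdeg : (Polynomial.X : Polynomial F).degree < (Fintype.card F : ℕ) := by
      rw [Polynomial.degree_X]
      exact_mod_cast hq
    have hdeg' : (Polynomial.X ^ Fintype.card F - Polynomial.X : Polynomial F).degree =
        Fintype.card F := by
      rw [Polynomial.degree_sub_eq_left_of_degree_lt (by rwa [Polynomial.degree_X_pow]),
        Polynomial.degree_X_pow]
    refine Polynomial.eq_of_degree_le_of_eval_finset_eq univ (by simp) ?_ ?_ ?_
    · rw [Lagrange.degree_nodal, hdeg', card_univ]
    · rw [Lagrange.nodal_monic.leadingCoeff, (Polynomial.monic_X_pow_sub (by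
        rw [Polynomial.degree_X]; exact_mod_cast hq)).leadingCoeff]
    · intro y _
      rw [show y = id y from rfl, Lagrange.eval_nodal_at_node (mem_univ y)]
      simp [FiniteField.pow_card]
  have h := Lagrange.eval_nodal_derivative_eval_node_eq (v := (id : F → F)) (mem_univ x)
  rw [hnodal, Lagrange.eval_nodal] at h
  simpa [Polynomial.derivative_X_pow] using h.symm

theorem prod_compl_mul_prod_erase {x : F} {S : Finset F} (hx : x ∈ S) :
    (∏ y ∈ Sᶜ, (x - y)) * ∏ y ∈ S.erase x, (x - y) = -1 := by
  rw [← prod_erase_univ_sub x, ← prod_union]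
  · congr 1
    ext y
    simp only [mem_union, mem_compl, mem_erase, mem_univ]
    grind
  · rw [disjoint_left]
    intro y hy hy'
    exact mem_compl.mp hy (mem_of_mem_erase hy')

/-- The product of the divided differences of `f` at the sets `C ∪ {y}`. -/
def prodInsertDivDiff (f : F → F) (C : Finset F) : F :=
  ∏ y ∈ Cᶜ, divDiff f (insert y C)

variable {f : F → F} {k : ℕ}

theorem prodInsertDivDiff_ne_zero (hf : ∀ Z : Finset F, Z.card = k + 1 → divDiff f Z ≠ 0)
    {C : Finset F} (hC : C.card = k) : prodInsertDivDiff f C ≠ 0 :=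
  prod_ne_zero_iff.mpr fun y hy => hf _ (by
    rw [card_insert_of_notMem (mem_compl.mp hy), hC])

/-- The values missed by `x ↦ divDiff f (insert x X)` satisfy an analogue of Segre's lemma of
tangents. -/
theorem prod_missed_values (hf : ∀ Z : Finset F, Z.card = k + 2 → divDiff f Z ≠ 0)
    {X : Finset F} (hX : X.card = k) {y : F} (hy : y ∉ X) :
    (∏ c ∈ (Xᶜ.image fun x => divDiff f (insert x X))ᶜ, (divDiff f (insert y X) - c)) =
      (∏ x ∈ X, (y - x)) / prodInsertDivDiff f (insert y X) := by
  have hval : ∀ z ∈ Xᶜ.erase y, divDiff f (insert y X) - divDiff f (insert z X) =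
      (y - z) * divDiff f (insert z (insert y X)) := by
    intro z hz
    obtain ⟨hzy, hz⟩ := mem_erase.mp hz
    rw [divDiff_insert_sub f hy (mem_compl.mp hz) hzy.symm, insert_comm]
  have hcard : ∀ z ∈ Xᶜ.erase y, (insert z (insert y X)).card = k + 2 := by
    intro z hz
    obtain ⟨hzy, hz⟩ := mem_erase.mp hz
    rw [card_insert_of_notMem (by simpa [hzy] using hz), card_insert_of_notMem hy, hX]
  have hy' : y ∈ Xᶜ := mem_compl.mpr hy
  -- Both the values taken off `X` and the points off `X` complete to all of `F`, so both full
  -- products are `-1`; comparing them isolates the missed values.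
  have h1 := prod_compl_mul_prod_erase (mem_image_of_mem (fun x => divDiff f (insert x X)) hy')
  have h2 := prod_compl_mul_prod_erase hy'
  have herase : (Xᶜ.image fun x => divDiff f (insert x X)).erase (divDiff f (insert y X)) =
      (Xᶜ.erase y).image fun x => divDiff f (insert x X) := by
    ext c
    simp only [mem_erase, mem_image]
    constructor
    · rintro ⟨hc, x, hx, rfl⟩
      exact ⟨x, ⟨fun h => hc (by rw [h]), hx⟩, rfl⟩
    · rintro ⟨x, ⟨hxy, hx⟩, rfl⟩
      refine ⟨fun h => ?_, x, hx, rfl⟩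
      have hm : x ∈ Xᶜ.erase y := mem_erase.mpr ⟨hxy, hx⟩
      have h3 := hval x hm
      rw [h, sub_self] at h3
      exact mul_ne_zero (sub_ne_zero.mpr (Ne.symm hxy)) (hf _ (hcard x hm)) h3.symm
  have hinj : Set.InjOn (fun x => divDiff f (insert x X)) (Xᶜ.erase y : Finset F) := by
    intro a ha b hb hab
    by_contra hne
    have ha' := mem_erase.mp ha
    have hb' := mem_erase.mp hb
    have h3 := divDiff_insert_sub f (mem_compl.mp ha'.2) (mem_compl.mp hb'.2) hne
    have hab' : divDiff f (insert a X) = divDiff f (insert b X) := hab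
    rw [hab', sub_self] at h3
    refine mul_ne_zero (sub_ne_zero.mpr hne) (hf _ ?_) h3.symm
    rw [card_insert_of_notMem (by simpa [hne] using ha'.2),
      card_insert_of_notMem (mem_compl.mp hb'.2), hX]
  have hN : prodInsertDivDiff f (insert y X) =
      ∏ z ∈ Xᶜ.erase y, divDiff f (insert z (insert y X)) := by
    unfold prodInsertDivDiff
    rw [compl_insert]
  have hN0 : prodInsertDivDiff f (insert y X) ≠ 0 :=
    prodInsertDivDiff_ne_zero (k := k + 1) hf (by rw [card_insert_of_notMem hy, hX])
  rw [compl_compl] at h2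
  rw [herase, prod_image hinj, prod_congr rfl hval, prod_mul_distrib, ← hN] at h1
  rw [eq_div_iff hN0]
  have hQ : ∏ z ∈ Xᶜ.erase y, (y - z) ≠ 0 := by
    intro h0
    rw [h0, mul_zero] at h2
    simp at h2
  apply mul_right_cancel₀ hQ
  linear_combination h1 - h2

/-- The map `x ↦ divDiff f (insert x X)` is injective off `X`, so it misses exactly `k` values.
Their monic nodal polynomial has leading coefficient 1, which Lagrange interpolation at the images
of the `k + 1` points of `Y` expresses as this sum. -/
theorem sum_tangents_eq_one (hf : ∀ Z : Finset F, Z.card = k + 2 → divDiff f Z ≠ 0)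
    {X Y : Finset F} (hX : X.card = k) (hY : Y.card = k + 1) (hXY : Disjoint X Y) :
    ∑ y ∈ Y, (∏ x ∈ X, (y - x)) / (∏ z ∈ Y.erase y, (y - z)) *
      (prodInsertDivDiff f (insert y X) *
        ∏ z ∈ Y.erase y, divDiff f (insert z (insert y X)))⁻¹ = 1 := by
  set g : F → F := fun x => divDiff f (insert x X) with hg
  have hsub : ∀ a ∉ X, ∀ b ∉ X, a ≠ b → g a - g b = (a - b) * divDiff f (insert b (insert a X)) := by
    intro a ha b hb hab
    rw [hg]
    simp only
    rw [divDiff_insert_sub f ha hb hab, insert_comm]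
  have hinj : Set.InjOn g (Xᶜ : Finset F) := by
    intro a ha b hb hab
    by_contra hne
    have ha' : a ∉ X := mem_compl.mp ha
    have hb' : b ∉ X := mem_compl.mp hb
    have h3 := hsub a ha' b hb' hne
    rw [hab, sub_self] at h3
    refine mul_ne_zero (sub_ne_zero.mpr hne) (hf _ ?_) h3.symm
    rw [card_insert_of_notMem (by simp [Ne.symm hne, hb']), card_insert_of_notMem ha', hX]
  have hYX : ∀ y ∈ Y, y ∉ X := fun y hy hyX => disjoint_left.mp hXY hyX hy
  have hinjY : Set.InjOn g Y := hinj.mono fun y hy => mem_coe.mpr (mem_compl.mpr (hYX y hy))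
  set R : Polynomial F := Lagrange.nodal (Xᶜ.image g)ᶜ id with hR
  have hXq : X.card ≤ Fintype.card F := card_le_univ X
  have hdeg : R.natDegree = k := by
    rw [hR, Lagrange.natDegree_nodal, card_compl, card_image_of_injOn hinj, card_compl]
    omega
  have hcoeff := Lagrange.coeff_eq_sum (P := R) hinjY (by
    rw [Polynomial.degree_eq_natDegree Lagrange.nodal_ne_zero, hdeg, hY]
    exact_mod_cast Nat.lt_succ_self k)
  have hlead : R.coeff (Y.card - 1) = 1 := by
    rw [hY, Nat.add_sub_cancel, ← hdeg]
    exact Lagrange.nodal_monic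
  rw [hlead] at hcoeff
  rw [hcoeff]
  refine sum_congr rfl fun y hy => ?_
  have hprod : ∏ z ∈ Y.erase y, (g y - g z) =
      (∏ z ∈ Y.erase y, (y - z)) * ∏ z ∈ Y.erase y, divDiff f (insert z (insert y X)) := by
    rw [← prod_mul_distrib]
    refine prod_congr rfl fun z hz => ?_
    exact hsub y (hYX y hy) z (hYX z (mem_of_mem_erase hz)) (ne_of_mem_erase hz).symm
  rw [hprod, hR, Lagrange.eval_nodal]
  have := prod_missed_values hf hX (hYX y hy)
  simp only [id_eq]
  rw [this]
  simp only [div_eq_mul_inv, mul_inv]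
  ring

/-- In low dimension the normalized products of divided differences are trivial. -/
theorem prodInsertDivDiff_mul_prod_eq_one
    (hf : ∀ Z : Finset F, Z.card = k + 2 → divDiff f Z ≠ 0)
    (hchar : ∀ j : ℕ, 0 < j → j ≤ k + 1 → (j : F) ≠ 0)
    {C W : Finset F} (hC : C.card = k + 1) (hW : W.card = k) (hCW : Disjoint C W) :
    prodInsertDivDiff f C * ∏ z ∈ W, divDiff f (insert z C) = 1 := by
  set E := C ∪ W with hE
  have hEcard : E.card = 2 * k + 1 := by
    rw [hE, card_union_of_disjoint hCW]
    omega
  set u : Finset F → F := fun C =>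
    (prodInsertDivDiff f C * ∏ z ∈ E \ C, divDiff f (insert z C))⁻¹ with hu
  set V : Finset F → F := fun C => ∏ z ∈ E \ C, ∏ x ∈ C, (x - z)⁻¹ with hV
  have key := eq_zero_of_sum_insert_eq_zero (n := k + 1) (E := E) (by omega) hchar
    (U := fun C => (u C - 1) * V C) (by
      intro X hXE hX
      have hX : X.card = k := by omega
      set Y := E \ X with hYdef
      have hY : Y.card = k + 1 := by
        rw [hYdef, card_sdiff_of_subset hXE]
        omega
      have hXY : Disjoint X Y := disjoint_sdiff
      have h1 := sum_tangents_eq_one hf hX hY hXY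
      -- For `x^(k+1)` all relevant differences are 1. Subtracting its relation makes the one for `u
      -- - 1` homogeneous.
      have h0 := sum_tangents_eq_one (f := fun x => x ^ (k + 1)) (fun Z hZ => by
        rw [divDiff_pow_card_sub_one hZ]
        exact one_ne_zero) hX hY hXY
      have hset : ∀ y ∈ Y, E \ insert y X = Y.erase y := by
        intro y _
        rw [hYdef, sdiff_insert]
      have hone : ∀ y ∈ Y, (prodInsertDivDiff (fun x => x ^ (k + 1)) (insert y X) *
          ∏ z ∈ Y.erase y, divDiff (fun x => x ^ (k + 1)) (insert z (insert y X))) = 1 := by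
        intro y hy
        have hyX : y ∉ X := (mem_sdiff.mp hy).2
        have hc : (insert y X).card = k + 1 := by rw [card_insert_of_notMem hyX, hX]
        have hz : ∀ z ∉ insert y X,
            divDiff (fun x => x ^ (k + 1)) (insert z (insert y X)) = 1 := fun z hz =>
          divDiff_pow_card_sub_one (by rw [card_insert_of_notMem hz, hc])
        unfold prodInsertDivDiff
        rw [prod_eq_one fun z hz' => hz z (mem_compl.mp hz'), prod_eq_one, mul_one]
        intro z hz'
        refine hz z fun hmem => ?_
        rcases mem_insert.mp hmem with h | h
        · exact ne_of_mem_erase hz' h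
        · exact (mem_sdiff.mp (mem_of_mem_erase hz')).2 h
      have h0' : ∑ y ∈ Y, (∏ x ∈ X, (y - x)) / (∏ z ∈ Y.erase y, (y - z)) = 1 := by
        rw [← h0]
        refine sum_congr rfl fun y hy => ?_
        rw [hone y hy, inv_one, mul_one]
      calc ∑ y ∈ Y, (u (insert y X) - 1) * V (insert y X)
          = ((∏ z ∈ Y, ∏ x ∈ X, (x - z)⁻¹) * (-1) ^ X.card) *
              (∑ y ∈ Y, (∏ x ∈ X, (y - x)) / (∏ z ∈ Y.erase y, (y - z)) *
                (prodInsertDivDiff f (insert y X) *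
                  ∏ z ∈ Y.erase y, divDiff f (insert z (insert y X)))⁻¹ -
              ∑ y ∈ Y, (∏ x ∈ X, (y - x)) / (∏ z ∈ Y.erase y, (y - z))) := by
            rw [← sum_sub_distrib, mul_sum]
            refine sum_congr rfl fun y hy => ?_
            simp only [hu, hV]
            rw [hset y hy, prod_cross_differences hXY hy]
            ring
        _ = 0 := by rw [h1, h0', sub_self, mul_zero])
    (C := C) subset_union_left hC
  have hEC : E \ C = W := by
    rw [hE, union_sdiff_left]
    exact sdiff_eq_self_of_disjoint hCW.symm
  simp only [hu, hV, hEC] at key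
  have hV0 : ∏ z ∈ W, ∏ x ∈ C, (x - z)⁻¹ ≠ 0 :=
    prod_ne_zero_iff.mpr fun z hz => prod_ne_zero_iff.mpr fun x hx =>
      inv_ne_zero (sub_ne_zero.mpr fun h => disjoint_left.mp hCW hx (h ▸ hz))
  have := (mul_eq_zero.mp key).resolve_right hV0
  exact inv_eq_one.mp (sub_eq_zero.mp this)

/-- Half of the classification of deep holes of Reed-Solomon codes: the low dimensional case. -/
theorem divDiff_eq_zero_of_small (hk : 0 < k)
    (hf : ∀ Z : Finset F, Z.card = k + 2 → divDiff f Z ≠ 0)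
    (hchar : ∀ j : ℕ, 0 < j → j ≤ k + 1 → (j : F) ≠ 0)
    (hq : 2 * (k + 1) ≤ Fintype.card F) {Z : Finset F} (hZ : Z.card = k + 3) :
    divDiff f Z = 0 := by
  obtain ⟨a, ha, b, hb, hab⟩ : ∃ a ∈ Z, ∃ b ∈ Z, a ≠ b := one_lt_card.mp (by omega)
  have hb' : b ∈ Z.erase a := mem_erase.mpr ⟨hab.symm, hb⟩
  set C := (Z.erase a).erase b with hCdef
  have hC : C.card = k + 1 := by
    rw [hCdef, card_erase_of_mem hb', card_erase_of_mem ha]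
    omega
  have haC : a ∉ C := fun h => notMem_erase a Z (mem_of_mem_erase h)
  have hbC : b ∉ C := notMem_erase b _
  have hZC : insert a (insert b C) = Z := by rw [hCdef, insert_erase hb', insert_erase ha]
  -- One place is left free in `W`, to be filled by `a` or by `b`.
  obtain ⟨W, hWZ, hW⟩ := exists_subset_card_eq (s := Zᶜ) (n := k - 1) (by
    rw [card_compl]; omega)
  have hWnot : ∀ z ∈ Z, z ∉ W := fun z hz hzW => mem_compl.mp (hWZ hzW) hz
  have hCZ : C ⊆ Z := (erase_subset _ _).trans (erase_subset _ _)
  have hCW : Disjoint C W := disjoint_left.mpr fun x hx => hWnot x (hCZ hx)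
  have key : ∀ c ∈ Z, c ∉ C →
      prodInsertDivDiff f C * (divDiff f (insert c C) * ∏ z ∈ W, divDiff f (insert z C)) = 1 := by
    intro c hc hcC
    rw [← prod_insert (f := fun z => divDiff f (insert z C)) (hWnot c hc)]
    refine prodInsertDivDiff_mul_prod_eq_one hf hchar hC ?_ (disjoint_insert_right.mpr ⟨hcC, hCW⟩)
    rw [card_insert_of_notMem (hWnot c hc), hW]
    omega
  have h1 := key a ha haC
  have h2 := key b hb hbC
  have h3 := divDiff_insert_sub f haC hbC hab
  rw [hZC] at h3
  set M := prodInsertDivDiff f C * ∏ z ∈ W, divDiff f (insert z C) with hM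
  have hM0 : M ≠ 0 := by
    intro h0
    exact one_ne_zero (α := F) (by
      rw [← h1]; linear_combination (divDiff f (insert a C)) * (h0.symm.trans hM).symm)
  have h4 : M * ((a - b) * divDiff f Z) = 0 := by
    rw [← h3]
    linear_combination h1 - h2 + (divDiff f (insert a C) - divDiff f (insert b C)) * hM
  exact (mul_eq_zero.mp ((mul_eq_zero.mp h4).resolve_left hM0)).resolve_left (sub_ne_zero.mpr hab)

end LowDimension

/-! ### The degree criterion. -/

theorem two_eq_zero_iff_even_card (F : Type*) [Field F] [Fintype F] :
    (2 : F) = 0 ↔ Even (Fintype.card F) := by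
  rw [Nat.even_iff, ← FiniteField.even_card_iff_char_two]
  constructor
  · intro h
    by_contra hne
    exact Ring.two_ne_zero hne h
  · intro h
    have := ringChar.Nat.cast_ringChar (R := F)
    rw [h] at this
    exact_mod_cast this

/-- A polynomial function on `F` with no vanishing divided difference at `k` points has degree
`k - 1`, in the ranges of `k` where deep holes of Reed-Solomon codes are classified. -/
theorem degree_eq_of_divDiff_ne_zero {F : Type*} [Field F] [Fintype F] [DecidableEq F]
    (p k : ℕ) [CharP F p] (hk : 3 ≤ k ∧ k + 2 ≤ Fintype.card F)
    (hk_even : Even (Fintype.card F) → k + 3 ≤ Fintype.card F)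
    (hkp : k ≤ p ∨ (Fintype.card F + 1) / 2 ≤ k) {G : Polynomial F}
    (hG : G.degree < Fintype.card F)
    (hf : ∀ Z : Finset F, Z.card = k → divDiff (fun x => G.eval x) Z ≠ 0) :
    G.degree = ((k - 1 : ℕ) : WithBot ℕ) := by
  have hvanish : ∀ Z : Finset F, Z.card = k + 1 → divDiff (fun x => G.eval x) Z = 0 := by
    intro Z hZ
    by_cases hlarge : (Fintype.card F + 1) / 2 ≤ k
    · refine divDiff_eq_zero_of_large hf (fun D hD => ?_) hk.2
        (fun h2 => hk_even ((two_eq_zero_iff_even_card F).mp h2)) hZ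
      unfold IsLargeSubset
      rw [hD]
      by_cases h2 : (2 : F) = 0
      · have := (two_eq_zero_iff_even_card F).mp h2
        exact Or.inr ⟨h2, by omega⟩
      · have := Nat.not_even_iff_odd.mp (mt (two_eq_zero_iff_even_card F).mpr h2)
        obtain ⟨r, hr⟩ := this
        exact Or.inl ⟨h2, by omega⟩
    -- The low dimensional lemma is indexed by `k - 2`; it needs only `1, …, k - 1` invertible, so
    -- `k = p` is allowed.
    · obtain ⟨l, rfl⟩ : ∃ l, k = l + 2 := ⟨k - 2, by omega⟩
      have hp : l + 2 ≤ p := hkp.resolve_right hlarge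
      refine divDiff_eq_zero_of_small (k := l) (by omega) hf (fun j hj hjl h0 => ?_) (by omega) hZ
      have := Nat.le_of_dvd hj ((CharP.cast_eq_zero_iff F p j).mp h0)
      omega
  obtain ⟨Z, -, hZ⟩ := Finset.exists_subset_card_eq (s := (Finset.univ : Finset F)) (n := k) (by
    rw [Finset.card_univ]; omega)
  obtain ⟨P, hPdeg, hP⟩ := eq_eval_of_divDiff_eq_zero (f := fun x => G.eval x) (Z := Z)
    fun x hx => hvanish _ (by rw [Finset.card_insert_of_notMem hx, hZ])
  have hGP : G = P := by
    refine Polynomial.eq_of_degrees_lt_of_eval_finset_eq Finset.univ ?_ ?_ fun x _ => hP x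
    · rwa [Finset.card_univ]
    · refine hPdeg.trans_le ?_
      exact_mod_cast Finset.card_le_univ Z
  rw [← hGP] at hPdeg
  have hcoeff := hf Z hZ
  rw [divDiff_eval hPdeg, hZ] at hcoeff
  refine le_antisymm ?_ (Polynomial.le_degree_of_ne_zero hcoeff)
  rw [Polynomial.degree_le_iff_coeff_zero]
  intro n hn
  refine Polynomial.coeff_eq_zero_of_degree_lt (hPdeg.trans_le ?_)
  have : k - 1 < n := by exact_mod_cast hn
  rw [hZ]
  exact_mod_cast (by omega : k ≤ n)

theorem degree_associatedReduction_lt (F : Type*) [Field F] [Fintype F] (k m : ℕ) (a : ℕ → F) :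
    (associatedReduction F k m a).degree < Fintype.card F := by
  have hX : (Polynomial.X : Polynomial F).degree < (Fintype.card F : ℕ) := by
    rw [Polynomial.degree_X]
    exact_mod_cast Fintype.one_lt_card
  have hdeg : (Polynomial.X ^ Fintype.card F - Polynomial.X : Polynomial F).degree =
      Fintype.card F := by
    rw [Polynomial.degree_sub_eq_left_of_degree_lt (by rwa [Polynomial.degree_X_pow]),
      Polynomial.degree_X_pow]
  unfold associatedReduction
  rw [← hdeg]
  exact Polynomial.degree_modByMonic_lt _ (Polynomial.monic_X_pow_sub hX)

theorem one_le_numDistinctZeros_iff {F : Type*} [Field F] [Fintype F] [DecidableEq F] {k : ℕ}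
    (hk : 0 < k) (m : ℕ) (a : ℕ → F) :
    1 ≤ numDistinctZeros (completeSymmetric F k m a) ↔
      ∃ Z : Finset F, Z.card = k ∧
        divDiff (fun x => (associatedReduction F k m a).eval x) Z = 0 := by
  unfold numDistinctZeros
  rw [Nat.one_le_iff_ne_zero, ← Nat.pos_iff_ne_zero, Set.ncard_pos]
  constructor
  · rintro ⟨v, hv, hinj⟩
    have hinj : Function.Injective v := fun i j h => by
      by_contra hne
      exact hinj i j hne h
    refine ⟨Finset.univ.image v, ?_, ?_⟩
    · rw [Finset.card_image_of_injective _ hinj, Finset.card_univ, Fintype.card_fin]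
    · rw [← eval_completeSymmetric hk m a hinj, hv]
  · rintro ⟨Z, hZ, h0⟩
    set e := Z.equivFinOfCardEq hZ
    have hinj : Function.Injective fun i => (e.symm i : F) :=
      Subtype.val_injective.comp e.symm.injective
    have himage : Finset.univ.image (fun i => (e.symm i : F)) = Z := by
      ext x
      simp only [Finset.mem_image, Finset.mem_univ, true_and]
      exact ⟨fun ⟨i, hi⟩ => hi ▸ (e.symm i).2, fun hx => ⟨e ⟨x, hx⟩, by simp⟩⟩
    refine ⟨fun i => (e.symm i : F), ?_, fun i j hij h => hij (hinj h)⟩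
    rw [eval_completeSymmetric hk m a hinj, himage, h0]

theorem theorem2p5 {F : Type*} [Field F] [Fintype F] (p q k m : ℕ) [CharP F p]
    (hq : Fintype.card F = q)
    (hk : 3 ≤ k ∧ k + 2 ≤ q) (hk_even : Even q → 4 ≤ k ∧ k + 3 ≤ q)
    (hkp : k ≤ p ∨ (q + 1) / 2 ≤ k)
    (hm : 0 < m) (a : ℕ → F) (ha : a m ≠ 0) :
    1 ≤ numDistinctZeros (completeSymmetric F k m a) ↔
      (associatedReduction F k m a).degree ≠ ((k - 1 : ℕ) : WithBot ℕ) := by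
  classical
  subst hq
  rw [one_le_numDistinctZeros_iff (by omega)]
  constructor
  · rintro ⟨Z, hZ, h0⟩ hdeg
    rw [divDiff_eval (by rw [hdeg, hZ]; exact_mod_cast (by omega : k - 1 < k)), hZ] at h0
    exact Polynomial.coeff_ne_zero_of_eq_degree hdeg h0
  · intro hdeg
    by_contra! hf
    exact hdeg (degree_eq_of_divDiff_ne_zero p k hk (fun h => (hk_even h).2) hkp
      (degree_associatedReduction_lt F k m a) hf)
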